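/- For integers $n\ge 5$, let $GP(n,2)$ be the generalized Petersen graph: the simple graph on the $2n$ vertices $v_1,\dots,v_n,u_1,\dots,u_n$ with edges $v_iv_{i+1}$, $u_iu_{i+2}$ and $v_iu_i$ for $1\le i\le n$, where indices are taken modulo $n$. A coprime labeling of a finite simple graph $G$ with labels from $\{1,\dots,m\}$ is an injective map from the vertex set of $G$ to $\{1,\dots,m\}$ such that any two adjacent vertices receive relatively prime labels. The minimum coprime number $\mathfrak{pr}(G)$ is the smallest positive integer $m$ for which $G$ has such a labeling. **Theorem.** Let $n\ge 5$ be an integer, and write $n=5m+r$ with integers $m\ge 1$ and $0\le r\le 4$. Then $$\mathfrak{pr}(GP(n,2))=\begin{cases}12m-1 & \text{if } n=5m,\\ 12m+3 & \text{if } n=5m+1,\\ 12m+5 & \text{if } n=5m+2,\\ 12m+7 & \text{if } n=5m+3,\\ 12m+9 & \text{if } n=5m+4.\end{cases}$$ -/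

import Mathlib

/-- The generalized Petersen graph `GP(n,k)`. Indices are taken modulo `n`; `Sum.inl i` is the
outer vertex `v_i`, `Sum.inr i` is the inner vertex `u_i`, and the edges are `v_i v_{i+1}`,
`u_i u_{i+k}` and `v_i u_i`. -/
def generalizedPetersen (n k : ℕ) : SimpleGraph (ZMod n ⊕ ZMod n) :=
  SimpleGraph.fromRel fun x y =>
    match x, y with
    | Sum.inl i, Sum.inl j => j = i + 1
    | Sum.inr i, Sum.inr j => j = i + (k : ZMod n)
    | Sum.inl i, Sum.inr j => i = j
    | Sum.inr _, Sum.inl _ => False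

/-- `IsCoprimeLabeling G m l`: the map `l` labels the vertices of `G` by distinct integers from
`{1, …, m}` in such a way that adjacent vertices have relatively prime labels. -/
structure IsCoprimeLabeling {V : Type*} (G : SimpleGraph V) (m : ℕ) (l : V → ℕ) : Prop where
  injective : Function.Injective l
  mem_Icc : ∀ v, l v ∈ Set.Icc 1 m
  coprime : ∀ v w, G.Adj v w → Nat.Coprime (l v) (l w)

/-- The minimum coprime number of `G`: the smallest `m` for which `G` has a coprime labeling with
labels from `{1, …, m}`. -/
noncomputable def minCoprimeNumber {V : Type*} (G : SimpleGraph V) : ℕ :=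
  sInf {m : ℕ | ∃ l : V → ℕ, IsCoprimeLabeling G m l}

/-- For a finite graph the minimum is attained: labeling by distinct primes is coprime, so the
infimum above is over a nonempty set. -/
theorem isLeast_minCoprimeNumber {V : Type*} [Finite V] (G : SimpleGraph V) :
    IsLeast {m : ℕ | ∃ l : V → ℕ, IsCoprimeLabeling G m l} (minCoprimeNumber G) := by
  have hne : {m : ℕ | ∃ l : V → ℕ, IsCoprimeLabeling G m l}.Nonempty := by
    obtain ⟨N, ⟨e⟩⟩ := Finite.exists_equiv_fin V
    have hinj := Nat.nth_injective Nat.infinite_setOfPred_prime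
    have hp : ∀ i, (Nat.nth Nat.Prime i).Prime := Nat.prime_nth_prime
    refine ⟨Nat.nth Nat.Prime N, fun v => Nat.nth Nat.Prime (e v), ?_, ?_, ?_⟩
    · intro v w h
      exact e.injective (Fin.ext (hinj h))
    · intro v
      exact ⟨(hp _).one_le, Nat.nth_monotone Nat.infinite_setOfPred_prime (e v).isLt.le⟩
    · intro v w h
      refine (Nat.coprime_primes (hp _) (hp _)).2 fun h' => ?_
      exact h.ne (e.injective (Fin.ext (hinj h')))
  exact ⟨Nat.sInf_mem hne, fun _ hm => Nat.sInf_le hm⟩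

/-! ### Lower bound: the vertices with even labels form an independent set -/

/-! Even labels occupy an independent set, which meets five consecutive spokes in at most 4 vertices
(`five_spokes_le_four`), so there are at most `4n/5` of them. The remaining labels are odd and
number at most `(m + 1) / 2`, which bounds `m` below.

The bound is attained by an explicit labeling that shifts by 60 over each 25 indices. Adjacent
labels differ by numbers whose only prime factors are 2, 3 and 5, so the shift preserves coprimality
(`StablyCoprime.coprime_add`), and finite checks on at most 30 indices suffice. -/

theorem generalizedPetersen_adj_outer {n k : ℕ} (h : 1 < n) (i : ZMod n) :
    (generalizedPetersen n k).Adj (Sum.inl i) (Sum.inl (i + 1)) := by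
  have : Fact (1 < n) := ⟨h⟩
  rw [generalizedPetersen, SimpleGraph.fromRel_adj]
  exact ⟨by simp, Or.inl rfl⟩

theorem generalizedPetersen_adj_inner {n k : ℕ} (h0 : 0 < k) (hk : k < n) (i : ZMod n) :
    (generalizedPetersen n k).Adj (Sum.inr i) (Sum.inr (i + k)) := by
  have hne : (k : ZMod n) ≠ 0 := fun h =>
    absurd (Nat.le_of_dvd h0 ((ZMod.natCast_eq_zero_iff k n).1 h)) (not_le.2 hk)
  rw [generalizedPetersen, SimpleGraph.fromRel_adj]
  exact ⟨by simpa using hne, Or.inl rfl⟩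

theorem generalizedPetersen_adj_spoke {n k : ℕ} (i : ZMod n) :
    (generalizedPetersen n k).Adj (Sum.inl i) (Sum.inr i) := by
  rw [generalizedPetersen, SimpleGraph.fromRel_adj]
  exact ⟨by simp, Or.inl rfl⟩

/-- Among five consecutive spokes, an independent set of `GP(n,2)` misses at least one. -/
theorem five_spokes_le_four {a b : Fin 5 → ℕ} (hab : ∀ i, a i + b i ≤ 1)
    (ha : ∀ i : Fin 4, a i.castSucc + a i.succ ≤ 1)
    (hb : ∀ i : Fin 3, b i.castSucc.castSucc + b i.succ.succ ≤ 1) :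
    ∑ i, (a i + b i) ≤ 4 := by
  simp only [Fin.sum_univ_five]
  have h0 := hab 0
  have h1 := hab 1
  have h2 := hab 2
  have h3 := hab 3
  have h4 := hab 4
  have a0 : a 0 + a 1 ≤ 1 := ha 0
  have a1 : a 1 + a 2 ≤ 1 := ha 1
  have a2 : a 2 + a 3 ≤ 1 := ha 2
  have a3 : a 3 + a 4 ≤ 1 := ha 3
  have b0 : b 0 + b 2 ≤ 1 := hb 0
  have b1 : b 1 + b 3 ≤ 1 := hb 1
  have b2 : b 2 + b 4 ≤ 1 := hb 2
  -- If every spoke were met, then `a 2 = 1` would force `a 1 = a 3 = 0`. So would `a 2 = 0`, since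
  -- then `b 2 = 1`, whence `a 0 = a 4 = 1`. Either way `b 1 = b 3 = 1`, a contradiction.
  omega

/-- The independence number of `GP(n,2)` is at most `4n/5`. -/
theorem five_mul_card_le_of_isIndepSet {n : ℕ} [NeZero n] (hn : 5 ≤ n)
    (p : ZMod n ⊕ ZMod n → Prop) [DecidablePred p]
    (hp : ∀ v w, (generalizedPetersen n 2).Adj v w → ¬ (p v ∧ p w)) :
    5 * (Finset.univ.filter p).card ≤ 4 * n := by
  set f : ZMod n ⊕ ZMod n → ℕ := fun v => if p v then 1 else 0 with hf
  have hf1 : ∀ v w, (generalizedPetersen n 2).Adj v w → f v + f w ≤ 1 := by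
    intro v w hvw
    have := hp v w hvw
    simp only [hf]
    split_ifs <;> simp_all
  set c : ZMod n → ℕ := fun i => f (Sum.inl i) + f (Sum.inr i) with hc
  have hcard : (Finset.univ.filter p).card = ∑ i, c i := by
    rw [Finset.card_filter, Fintype.sum_sum_type, ← Finset.sum_add_distrib]
  have hwin : ∀ i : ZMod n, ∑ j : Fin 5, c (i + ((j : ℕ) : ZMod n)) ≤ 4 := by
    intro i
    refine five_spokes_le_four (a := fun j => f (Sum.inl (i + ((j : ℕ) : ZMod n))))
      (b := fun j => f (Sum.inr (i + ((j : ℕ) : ZMod n)))) ?_ ?_ ?_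
    · intro j
      exact hf1 _ _ (generalizedPetersen_adj_spoke _)
    · intro j
      have := hf1 _ _ (generalizedPetersen_adj_outer (k := 2) (by omega : 1 < n)
        (i + ((j : ℕ) : ZMod n)))
      simpa [add_assoc] using this
    · intro j
      have := hf1 _ _ (generalizedPetersen_adj_inner (by omega : 0 < 2) (by omega : 2 < n)
        (i + ((j : ℕ) : ZMod n)))
      have e : i + ((j : ℕ) : ZMod n) + ((2 : ℕ) : ZMod n)
          = i + (((j : ℕ) + 1 + 1 : ℕ) : ZMod n) := by push_cast; ring
      rw [e] at this
      simpa using this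
  have hsum : ∑ i : ZMod n, ∑ j : Fin 5, c (i + ((j : ℕ) : ZMod n)) = 5 * ∑ i, c i := by
    rw [Finset.sum_comm]
    have : ∀ j : Fin 5, ∑ i : ZMod n, c (i + ((j : ℕ) : ZMod n)) = ∑ i, c i := fun j =>
      Equiv.sum_comp (Equiv.addRight ((j : ℕ) : ZMod n)) c
    simp [this]
  calc 5 * (Finset.univ.filter p).card
      = ∑ i : ZMod n, ∑ j : Fin 5, c (i + ((j : ℕ) : ZMod n)) := by rw [hcard, hsum]
    _ ≤ ∑ _i : ZMod n, 4 := Finset.sum_le_sum fun i _ => hwin i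
    _ = 4 * n := by simp [ZMod.card, mul_comm]

/-- An injective labeling by `{1, …, m}` uses at most `(m + 1) / 2` odd labels. -/
theorem card_odd_labels_le {V : Type*} [Fintype V] {m : ℕ} {l : V → ℕ}
    (hl : Function.Injective l) (hm : ∀ v, l v ∈ Set.Icc 1 m) :
    (Finset.univ.filter fun v => ¬ 2 ∣ l v).card ≤ (m + 1) / 2 := by
  rw [← Finset.card_range ((m + 1) / 2)]
  refine Finset.card_le_card_of_injOn (fun v => l v / 2) ?_ ?_
  · intro v hv
    have h1 := (hm v).2
    simp only [Finset.coe_filter, Finset.mem_univ, true_and, Set.mem_ofPred_eq] at hv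
    simp only [Finset.coe_range, Set.mem_Iio]
    omega
  · intro v hv w hw hvw
    simp only [Finset.coe_filter, Finset.mem_univ, true_and, Set.mem_ofPred_eq] at hv hw
    simp only at hvw
    exact hl (by omega)

theorem le_of_isCoprimeLabeling {n m : ℕ} (hn : 5 ≤ n) {l : ZMod n ⊕ ZMod n → ℕ}
    (hl : IsCoprimeLabeling (generalizedPetersen n 2) m l) :
    4 * n - 2 * (4 * n / 5) - 1 ≤ m := by
  have : NeZero n := ⟨by omega⟩
  have hE := five_mul_card_le_of_isIndepSet hn (fun v => 2 ∣ l v) fun v w hvw h =>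
    Nat.not_coprime_of_dvd_of_dvd one_lt_two h.1 h.2 (hl.coprime v w hvw)
  have hO := card_odd_labels_le hl.injective hl.mem_Icc
  have hadd := Finset.card_filter_add_card_filter_not (s := (Finset.univ : Finset (ZMod n ⊕ ZMod n)))
    (fun v => 2 ∣ l v)
  simp only [Finset.card_univ, Fintype.card_sum, ZMod.card] at hadd
  omega

/-! ### Upper bound: a labeling that is periodic up to a translation -/

/-- Labels of the first 25 outer (`false`) or inner (`true`) vertices. -/
def labelTable : Bool → List ℕ
  | false => [1, 3, 4, 7, 10, 19, 15, 16, 13, 22, 25, 27, 28, 33, 34,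
      39, 47, 46, 37, 40, 49, 55, 56, 57, 52]
  | true => [2, 8, 5, 11, 9, 20, 14, 21, 17, 23, 26, 32, 31, 35, 29,
      44, 38, 45, 41, 43, 50, 58, 51, 59, 53]

/-- Labels, up to a translation, of the last `r = n % 5` outer or inner vertices. -/
def labelTail (r : ℕ) : Bool → List ℕ
  | false => if r < 3 then [1, 2] else [1, 4, 7, 8]
  | true => if r < 3 then [3, 5] else [2, 5, 3, 9]

/-- The label of the vertex `v_i` (`false`) or `u_i` (`true`) of `GP(n,2)`: the table, with 60 added
for every period, at the first `5 * (n / 5)` indices, and the tail after that. -/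
def petersenLabel (n : ℕ) (b : Bool) (i : ℕ) : ℕ :=
  if i < 5 * (n / 5) then 60 * (i / 25) + (labelTable b).getD (i % 25) 0
  else 12 * (n / 5) + (labelTail (n % 5) b).getD (i - 5 * (n / 5)) 0

theorem petersenLabel_add (q s : ℕ) (b : Bool) (i : ℕ) :
    petersenLabel (25 * q + s) b (25 * q + i) = 60 * q + petersenLabel s b i := by
  have h1 : (25 * q + s) / 5 = 5 * q + s / 5 := by omega
  have h2 : (25 * q + i) / 25 = q + i / 25 := by omega
  have h3 : (25 * q + i) % 25 = i % 25 := by omega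
  have h4 : 25 * q + i < 5 * (5 * q + s / 5) ↔ i < 5 * (s / 5) := by omega
  have h5 : 25 * q + i - 5 * (5 * q + s / 5) = i - 5 * (s / 5) := by omega
  have h6 : (25 * q + s) % 5 = s % 5 := by omega
  simp only [petersenLabel, h1, h2, h3, h4, h5, h6]
  split_ifs <;> ring

/-- At the first `5 * (n / 5)` indices the labels do not depend on `n`. -/
theorem petersenLabel_congr {n n' i : ℕ} (h : i < 5 * (n / 5)) (h' : i < 5 * (n' / 5)) (b : Bool) :
    petersenLabel n b i = petersenLabel n' b i := by
  simp [petersenLabel, h, h']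

theorem petersenLabel_eq_add_mod {n i j : ℕ} (hj : j < 30) (h : 25 * (i / 25) + j < 5 * (n / 5))
    (b : Bool) :
    petersenLabel n b (25 * (i / 25) + j) = 60 * (i / 25) + petersenLabel 30 b j := by
  rw [← petersenLabel_add]
  exact petersenLabel_congr h (by omega) b

/-- `a` and `b` are coprime, and stay so when the same multiple of 60 is added to both. -/
def StablyCoprime (a b : ℕ) : Prop := Nat.Coprime a b ∧ (a - b) + (b - a) ∣ 60 ^ 4

instance (a b : ℕ) : Decidable (StablyCoprime a b) :=
  inferInstanceAs (Decidable (_ ∧ _))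

/-- A common prime of the shifted labels divides their difference, hence 60, hence both `a` and `b`.
The exponent in `60 ^ 4` only makes room for differences such as 8 or 9. -/
theorem StablyCoprime.coprime_add {a b : ℕ} (h : StablyCoprime a b) (q : ℕ) :
    Nat.Coprime (60 * q + a) (60 * q + b) := by
  refine Nat.Coprime.symm (Nat.coprime_of_dvd fun p hp hb ha => ?_)
  have hd : p ∣ (a - b) + (b - a) := by
    have h1 := Nat.dvd_sub ha hb
    have h2 := Nat.dvd_sub hb ha
    rw [Nat.add_sub_add_left] at h1 h2
    exact dvd_add h1 h2
  have h60 : p ∣ 60 * q := (hp.dvd_of_dvd_pow (hd.trans h.2)).mul_right q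
  exact Nat.not_coprime_of_dvd_of_dvd hp.one_lt ((Nat.dvd_add_right h60).1 ha)
    ((Nat.dvd_add_right h60).1 hb) h.1

/-- Lengths 5 to 29 are the possible last parts; 30 is a full period with the start of the next,
covering the edges between them. -/
theorem stablyCoprime_spoke : ∀ s < 31, 5 ≤ s → ∀ i < s,
    StablyCoprime (petersenLabel s false i) (petersenLabel s true i) := by
  decide +kernel

theorem stablyCoprime_outer : ∀ s < 31, 5 ≤ s → ∀ i < s - 1,
    StablyCoprime (petersenLabel s false i) (petersenLabel s false (i + 1)) := by
  decide +kernel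

theorem stablyCoprime_inner : ∀ s < 31, 5 ≤ s → ∀ i < s - 2,
    StablyCoprime (petersenLabel s true i) (petersenLabel s true (i + 2)) := by
  decide +kernel

theorem petersenLabel_inner_odd : ∀ s < 30, 5 ≤ s →
    petersenLabel s true (s - 1) % 2 = 1 ∧ petersenLabel s true (s - 2) % 2 = 1 := by
  decide +kernel

theorem petersenLabel_mem_Icc_of_lt : ∀ s < 30, 5 ≤ s → ∀ b, ∀ i < s,
    petersenLabel s b i ∈ Finset.Icc 1 (4 * s - 2 * (4 * s / 5) - 1) := by
  decide +kernel

theorem petersenLabel_lt_sixty : ∀ b, ∀ i < 25, petersenLabel 30 b i ∈ Finset.Ioo 0 60 := by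
  decide +kernel

set_option synthInstance.maxSize 1000 in
theorem petersenLabel_injective_of_lt : ∀ s < 31, 5 ≤ s → ∀ b c, ∀ i < s, ∀ j < s,
    petersenLabel s b i = petersenLabel s c j → b = c ∧ i = j := by
  decide +kernel

/-- Every index is in a full period or in a last part of length between 5 and 29. -/
theorem petersenLabel_cases {n i : ℕ} (hn : 5 ≤ n) (hi : i < n) :
    ∃ q s j, i = 25 * q + j ∧ j < s ∧ 5 ≤ s ∧ ((s < 30 ∧ n = 25 * q + s) ∨
      (s = 30 ∧ j < 25 ∧ q < (n - 5) / 25 ∧ ∀ b, ∀ d ≤ 2,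
        petersenLabel n b (i + d) = 60 * q + petersenLabel 30 b (j + d))) := by
  -- Reserving five indices keeps `i + 2` in the range of the table when `i` lies in a full period.
  by_cases h : i < 25 * ((n - 5) / 25)
  · refine ⟨i / 25, 30, i % 25, by omega, by omega, by omega, Or.inr ⟨rfl, by omega, by omega, ?_⟩⟩
    intro b d hd
    rw [← petersenLabel_eq_add_mod (n := n) (by omega) (by omega)]
    congr 1
    omega
  · exact ⟨(n - 5) / 25, n - 25 * ((n - 5) / 25), i - 25 * ((n - 5) / 25), by omega, by omega,
      by omega, Or.inl ⟨by omega, by omega⟩⟩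

theorem coprime_petersenLabel_spoke {n i : ℕ} (hn : 5 ≤ n) (hi : i < n) :
    Nat.Coprime (petersenLabel n false i) (petersenLabel n true i) := by
  obtain ⟨q, s, j, rfl, hj, hs, ⟨hs', rfl⟩ | ⟨rfl, hj', -, h⟩⟩ := petersenLabel_cases hn hi
  · rw [petersenLabel_add, petersenLabel_add]
    exact (stablyCoprime_spoke s (by omega) hs j hj).coprime_add q
  · have h0 := fun b => h b 0 (by omega)
    rw [add_zero, add_zero] at h0
    rw [h0, h0]
    exact (stablyCoprime_spoke 30 (by omega) hs j hj).coprime_add q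

theorem coprime_petersenLabel_outer {n i : ℕ} (hn : 5 ≤ n) (hi : i < n) :
    Nat.Coprime (petersenLabel n false i) (petersenLabel n false ((i + 1) % n)) := by
  rcases eq_or_ne (i + 1) n with hin | hin
  · have h : petersenLabel n false 0 = 1 := by
      rw [petersenLabel, if_pos (by omega)]
      rfl
    rw [hin, Nat.mod_self, h]
    exact Nat.coprime_one_right _
  rw [Nat.mod_eq_of_lt (by omega)]
  obtain ⟨q, s, j, rfl, hj, hs, ⟨hs', rfl⟩ | ⟨rfl, hj', -, h⟩⟩ := petersenLabel_cases hn hi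
  · rw [add_assoc, petersenLabel_add, petersenLabel_add]
    exact (stablyCoprime_outer s (by omega) hs j (by omega)).coprime_add q
  · have h0 := h false 0 (by omega)
    rw [add_zero, add_zero] at h0
    rw [h0, h false 1 (by omega)]
    exact (stablyCoprime_outer 30 (by omega) hs j (by omega)).coprime_add q

theorem coprime_petersenLabel_inner {n i : ℕ} (hn : 5 ≤ n) (hi : i < n) :
    Nat.Coprime (petersenLabel n true i) (petersenLabel n true ((i + 2) % n)) := by
  by_cases hin : n ≤ i + 2
  · have h : ∃ k, petersenLabel n true ((i + 2) % n) = 2 ^ k := by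
      rw [Nat.mod_eq_sub_mod hin, Nat.mod_eq_of_lt (by omega)]
      rw [petersenLabel, if_pos (by omega)]
      obtain h | h : i + 2 - n = 0 ∨ i + 2 - n = 1 := by omega
      · exact ⟨1, by rw [h]; rfl⟩
      · exact ⟨3, by rw [h]; rfl⟩
    obtain ⟨k, hk⟩ := h
    rw [hk]
    refine Nat.Coprime.pow_right _ (Nat.coprime_two_right.2 (Nat.odd_iff.2 ?_))
    obtain ⟨q, s, j, rfl, hj, hs, ⟨hs', rfl⟩ | ⟨rfl, hj', hq, -⟩⟩ := petersenLabel_cases hn hi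
    · have h := petersenLabel_inner_odd s hs' hs
      rw [petersenLabel_add]
      obtain rfl | rfl : j = s - 1 ∨ j = s - 2 := by omega
      all_goals omega
    · omega
  rw [Nat.mod_eq_of_lt (by omega)]
  obtain ⟨q, s, j, rfl, hj, hs, ⟨hs', rfl⟩ | ⟨rfl, hj', -, h⟩⟩ := petersenLabel_cases hn hi
  · rw [add_assoc, petersenLabel_add, petersenLabel_add]
    exact (stablyCoprime_inner s (by omega) hs j (by omega)).coprime_add q
  · have h0 := h true 0 (by omega)
    rw [add_zero, add_zero] at h0
    rw [h0, h true 2 (by omega)]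
    exact (stablyCoprime_inner 30 (by omega) hs j (by omega)).coprime_add q

theorem petersenLabel_mem_Icc {n i : ℕ} (hn : 5 ≤ n) (hi : i < n) (b : Bool) :
    petersenLabel n b i ∈ Set.Icc 1 (4 * n - 2 * (4 * n / 5) - 1) := by
  obtain ⟨q, s, j, rfl, hj, hs, ⟨hs', rfl⟩ | ⟨rfl, hj', hq, h⟩⟩ := petersenLabel_cases hn hi
  · have h := Finset.mem_Icc.1 (petersenLabel_mem_Icc_of_lt s hs' hs b j hj)
    rw [petersenLabel_add, Set.mem_Icc]
    -- The bound grows by `4 * 25 - 2 * 20 = 60` per period, just as the labels do.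
    omega
  · have h0 := h b 0 (by omega)
    have h1 := Finset.mem_Ioo.1 (petersenLabel_lt_sixty b j hj')
    rw [add_zero, add_zero] at h0
    rw [h0, Set.mem_Icc]
    omega

/-- Full period `q` has its labels strictly between `60 * q` and `60 * q + 60`, and the last part
lies above all of these, so a collision would occur within one part. -/
theorem petersenLabel_injective {n i j : ℕ} (hn : 5 ≤ n) (hi : i < n) (hj : j < n) {b c : Bool}
    (hij : petersenLabel n b i = petersenLabel n c j) : b = c ∧ i = j := by
  obtain ⟨q, s, i, rfl, his, hs, ⟨hs', hns⟩ | ⟨rfl, hi', hq, h⟩⟩ := petersenLabel_cases hn hi <;>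
  obtain ⟨q', s', j, rfl, hjs, ht, ⟨ht', hnt⟩ | ⟨rfl, hj', hq', h'⟩⟩ := petersenLabel_cases hn hj
  · obtain rfl : q = q' := by omega
    obtain rfl : s = s' := by omega
    rw [hns, petersenLabel_add, petersenLabel_add] at hij
    have := petersenLabel_injective_of_lt s (by omega) hs b c i his j hjs (by omega)
    exact ⟨this.1, by omega⟩
  · have h1 := Finset.mem_Icc.1 (petersenLabel_mem_Icc_of_lt s hs' hs b i his)
    have h2 := Finset.mem_Ioo.1 (petersenLabel_lt_sixty c j hj')
    have h3 := h' c 0 (by omega)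
    rw [add_zero, add_zero] at h3
    rw [h3, hns, petersenLabel_add] at hij
    omega
  · have h1 := Finset.mem_Icc.1 (petersenLabel_mem_Icc_of_lt s' ht' ht c j hjs)
    have h2 := Finset.mem_Ioo.1 (petersenLabel_lt_sixty b i hi')
    have h3 := h b 0 (by omega)
    rw [add_zero, add_zero] at h3
    rw [h3, hnt, petersenLabel_add] at hij
    omega
  · have h1 := Finset.mem_Ioo.1 (petersenLabel_lt_sixty b i hi')
    have h2 := Finset.mem_Ioo.1 (petersenLabel_lt_sixty c j hj')
    have h3 := h b 0 (by omega)
    have h4 := h' c 0 (by omega)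
    rw [add_zero, add_zero] at h3 h4
    rw [h3, h4] at hij
    have := petersenLabel_injective_of_lt 30 (by omega) hs b c i his j hjs (by omega)
    exact ⟨this.1, by omega⟩

theorem exists_isCoprimeLabeling {n : ℕ} (hn : 5 ≤ n) :
    ∃ l, IsCoprimeLabeling (generalizedPetersen n 2) (4 * n - 2 * (4 * n / 5) - 1) l := by
  have : NeZero n := ⟨by omega⟩
  have hv1 : ∀ i : ZMod n, (i + 1).val = (i.val + 1) % n := fun i => by
    rw [ZMod.val_add, ZMod.val_one'' (by omega)]
  have hv2 : ∀ i : ZMod n, (i + (2 : ℕ)).val = (i.val + 2) % n := fun i => by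
    rw [ZMod.val_add, ZMod.val_natCast, Nat.add_mod_mod]
  refine ⟨Sum.elim (fun i => petersenLabel n false i.val) (fun i => petersenLabel n true i.val),
    ?_, ?_, ?_⟩
  · rintro (i | i) (j | j) hij <;>
      have h := petersenLabel_injective hn i.val_lt j.val_lt hij
    · exact congrArg Sum.inl (ZMod.val_injective n h.2)
    · exact absurd h.1 Bool.false_ne_true
    · exact absurd h.1.symm Bool.false_ne_true
    · exact congrArg Sum.inr (ZMod.val_injective n h.2)
  · rintro (i | i) <;> exact petersenLabel_mem_Icc hn i.val_lt _
  · intro v w hvw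
    rw [generalizedPetersen, SimpleGraph.fromRel_adj] at hvw
    obtain ⟨-, hvw⟩ := hvw
    have outer : ∀ i : ZMod n, Nat.Coprime (petersenLabel n false i.val)
        (petersenLabel n false (i + 1).val) := fun i => by
      rw [hv1]
      exact coprime_petersenLabel_outer hn i.val_lt
    have inner : ∀ i : ZMod n, Nat.Coprime (petersenLabel n true i.val)
        (petersenLabel n true (i + (2 : ℕ)).val) := fun i => by
      rw [hv2]
      exact coprime_petersenLabel_inner hn i.val_lt
    have spoke : ∀ i : ZMod n, Nat.Coprime (petersenLabel n false i.val)
        (petersenLabel n true i.val) := fun i => coprime_petersenLabel_spoke hn i.val_lt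
    rcases v with i | i <;> rcases w with j | j <;> rcases hvw with h | h
    · exact h ▸ outer i
    · exact h ▸ (outer j).symm
    · exact h ▸ spoke i
    · exact h.elim
    · exact h.elim
    · exact h ▸ (spoke j).symm
    · exact h ▸ inner i
    · exact h ▸ (inner j).symm

theorem minCoprimeNumber_generalizedPetersen_two {n : ℕ} (hn : 5 ≤ n) :
    minCoprimeNumber (generalizedPetersen n 2) = 4 * n - 2 * (4 * n / 5) - 1 := by
  have : NeZero n := ⟨by omega⟩
  refine (isLeast_minCoprimeNumber (generalizedPetersen n 2)).unique
    ⟨exists_isCoprimeLabeling hn, ?_⟩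
  rintro m ⟨l, hl⟩
  exact le_of_isCoprimeLabeling hn hl

theorem mainTheorem1 (n m : ℕ) (hn : 5 ≤ n) :
    (n = 5 * m → minCoprimeNumber (generalizedPetersen n 2) = 12 * m - 1) ∧
    (n = 5 * m + 1 → minCoprimeNumber (generalizedPetersen n 2) = 12 * m + 3) ∧
    (n = 5 * m + 2 → minCoprimeNumber (generalizedPetersen n 2) = 12 * m + 5) ∧
    (n = 5 * m + 3 → minCoprimeNumber (generalizedPetersen n 2) = 12 * m + 7) ∧
    (n = 5 * m + 4 → minCoprimeNumber (generalizedPetersen n 2) = 12 * m + 9) := by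
  rw [minCoprimeNumber_generalizedPetersen_two hn]
  omega
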